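/- Let $\mathbb{F}$ be a field, $G$ a group (not necessarily abelian), and $X$ a finite poset with incidence algebra $I(X)$ over $\mathbb{F}$. Assume that $\mathrm{char}\,\mathbb{F}=0$, or $\mathrm{char}\,\mathbb{F}>\dim I(X)$, or $G$ is abelian. Let $A$ and $A'$ be two $G$-gradings on the algebra $I(X)$, presented in upper block triangular form $$ A=\left(\begin{array}{cccc} \mathbb{F}H_1&M_{12}&\ldots&M_{1t}\\ &\ddots&\ddots&\vdots\\ &&\mathbb{F}H_{t-1}&M_{t-1,t}\\ &&&\mathbb{F}H_t \end{array}\right),\qquad A'= \left(\begin{array}{cccc} \mathbb{F}H_1'&M_{12}'&\ldots&M_{1t'}'\\ &\ddots&\ddots&\vdots\\ &&\mathbb{F}H_{t'-1}'&M_{t'-1,t'}'\\ &&&\mathbb{F}H_{t'}' \end{array}\right), $$ where the $H_i$ and $H'_i$ are finite abelian subgroups of $G$ whose orders are not divisible by $\mathrm{char}\,\mathbb{F}$ and such that $\mathbb{F}$ contains primitive roots of unity of orders $\exp H_i$ and $\exp H_i'$; each group algebra $\mathbb{F}H$ is graded by $\deg h=h$; each $M_{ij}$ is a graded $(\mathbb{F}H_i,\mathbb{F}H_j)$-bimodule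 and each $M'_{ij}$ a graded $(\mathbb{F}H'_i,\mathbb{F}H'_j)$-bimodule. In other words, if $e_i$ is the unit of $\mathbb{F}H_i$, then $e_1,\ldots,e_t$ are orthogonal idempotents of degree $1$ with sum $1$, $e_iAe_i\cong\mathbb{F}H_i$ as graded algebras, $e_iAe_j=M_{ij}$ for $i<j$, and $e_iAe_j=0$ for $i>j$; and similarly for $A'$. Let $\mathcal{E}=\{1,\ldots,t\}$ be the associated poset of $A$, with the partial order $i\trianglelefteq j$ if and only if $e_iAe_j\ne0$, and let $\mathcal{E}'=\{1,\ldots,t'\}$ be the associated poset of $A'$, defined in the same way. If $A\cong A'$ as $G$-graded algebras, then $t=t'$ and there exists an isomorphism of posets $\alpha:\mathcal{E}\to\mathcal{E}'$ such that $H_i=H'_{\alpha(i)}$ for each $i=1,\ldots,t$. -/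

import Mathlib

/-- A `G`-grading on an `F`-algebra `A`: a vector space decomposition `A = ⨁ g, A_g` into
(possibly zero) subspaces such that `A_g A_h ⊆ A_{gh}`. The group `G` is arbitrary and written
multiplicatively. -/
structure GroupGrading (F G A : Type*) [Field F] [Group G] [Ring A] [Algebra F A] where
  /-- The homogeneous component of degree `g`. -/
  component : G → Submodule F A
  isInternal : open Classical in DirectSum.IsInternal component
  mul_mem : ∀ {g h : G} {a b : A},
    a ∈ component g → b ∈ component h → a * b ∈ component (g * h)

/-- Two `G`-graded algebras are graded isomorphic if there is an isomorphism of algebras mapping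
each homogeneous component onto the homogeneous component of the same degree. -/
def GroupGrading.Isomorphic {F G A A' : Type*} [Field F] [Group G] [Ring A] [Algebra F A]
    [Ring A'] [Algebra F A'] (𝒜 : GroupGrading F G A) (𝒜' : GroupGrading F G A') : Prop :=
  ∃ ψ : A ≃ₐ[F] A', ∀ g : G, (𝒜.component g).map ψ.toLinearMap = 𝒜'.component g

/-- A presentation of a graded algebra as an upper block triangular algebra with diagonal blocks
the group algebras `F H₁, …, F H_t` (graded by `deg h = h`) and with graded
`(F H_i, F H_j)`-bimodules `M_{ij}` above the diagonal, where the `H_i` are finite abelian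
subgroups of `G` such that `char F ∤ |H_i|` and `F` contains a primitive root of unity of order
`exp H_i`.

It is given by the embeddings `F H_i → A` of the diagonal blocks. The image `e_i` of `1 ∈ F H_i`
is the unit of the `i`-th block, the `(i, j)` block is the Peirce component `e_i A e_j`, and
`M_{ij} = e_i A e_j` for `i < j`. As `e_i` is homogeneous of degree `1`, every `e_i A e_j` is a
graded subspace and a graded `(F H_i, F H_j)`-bimodule. -/
structure BlockForm {F G A : Type*} [Field F] [Group G] [Ring A] [Algebra F A]
    (𝒜 : GroupGrading F G A) {t : ℕ} (H : Fin t → Subgroup G) where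
  finite : ∀ i, Finite (H i)
  comm : ∀ i, IsMulCommutative (H i)
  not_dvd_card : ∀ i, ¬ ringChar F ∣ Nat.card (H i)
  primitiveRoot : ∀ i, ∃ ζ : F, IsPrimitiveRoot ζ (Monoid.exponent (H i))
  /-- The embedding of the diagonal block `F H_i`; it is not required to preserve `1`. -/
  diag : ∀ i, MonoidAlgebra F (H i) →ₙₐ[F] A
  diag_injective : ∀ i, Function.Injective (diag i)
  diag_mem : ∀ i (h : H i), diag i (MonoidAlgebra.single h 1) ∈ 𝒜.component (h : G)
  /-- The diagonal block `e_i A e_i` is exactly `F H_i`. -/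
  diag_surjective : ∀ i (a : A), ∃ c, diag i c = diag i 1 * a * diag i 1
  /-- The units of the diagonal blocks are orthogonal. -/
  orthogonal : ∀ i j, i ≠ j → diag i 1 * diag j 1 = 0
  /-- The units of the diagonal blocks add up to `1`. -/
  complete : ∑ i, diag i 1 = 1
  /-- The blocks below the diagonal are zero. -/
  upper : ∀ i j, j < i → ∀ a : A, diag i 1 * a * diag j 1 = 0

namespace BlockForm

section General

variable {F G A : Type*} [Field F] [Group G] [Ring A] [Algebra F A]
  {𝒜 : GroupGrading F G A} {t : ℕ} {H : Fin t → Subgroup G}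

/-- The unit `e_i` of the `i`-th diagonal block. -/
noncomputable def unit (B : BlockForm 𝒜 H) (i : Fin t) : A := B.diag i 1

/-- The `(i, j)` block `e_i A e_j`; it is `M_{ij}` for `i < j` and `F H_i` for `i = j`. -/
noncomputable def block (B : BlockForm 𝒜 H) (i j : Fin t) : Submodule F A :=
  LinearMap.range ((LinearMap.mulLeft F (B.unit i)).comp (LinearMap.mulRight F (B.unit j)))

/-- The underlying set `{1, …, t}` of the associated poset. -/
def AssociatedPoset (_B : BlockForm 𝒜 H) : Type := Fin t

/-- The number in `{1, …, t}` of an element of the associated poset. -/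
def index (B : BlockForm 𝒜 H) : B.AssociatedPoset ≃ Fin t := Equiv.refl _

theorem mem_block (B : BlockForm 𝒜 H) {i j : Fin t} {m : A} :
    m ∈ B.block i j ↔ ∃ a, B.unit i * a * B.unit j = m := by
  simp [block, mul_assoc]

theorem block_ne_bot (B : BlockForm 𝒜 H) {i j : Fin t} :
    B.block i j ≠ ⊥ ↔ ∃ a, B.unit i * a * B.unit j ≠ 0 := by
  simp only [Submodule.ne_bot_iff, mem_block]
  constructor
  · rintro ⟨_, ⟨a, rfl⟩, h⟩
    exact ⟨a, h⟩
  · rintro ⟨a, h⟩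
    exact ⟨_, ⟨a, rfl⟩, h⟩

theorem unit_mul_self (B : BlockForm 𝒜 H) (i : Fin t) : B.unit i * B.unit i = B.unit i := by
  rw [unit, ← map_mul, one_mul]

theorem unit_ne_zero (B : BlockForm 𝒜 H) (i : Fin t) : B.unit i ≠ 0 := by
  intro h
  exact one_ne_zero (B.diag_injective i (h.trans (map_zero _).symm))

theorem unit_mem (B : BlockForm 𝒜 H) (i : Fin t) : B.unit i ∈ 𝒜.component 1 :=
  B.diag_mem i 1

/-- A nonzero block contains a nonzero homogeneous element. -/
theorem exists_homogeneous (B : BlockForm 𝒜 H) {i j : Fin t} (h : B.block i j ≠ ⊥) :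
    ∃ (g : G) (m : A), m ∈ 𝒜.component g ∧ m ≠ 0 ∧ B.unit i * m * B.unit j = m := by
  classical
  obtain ⟨a, ha⟩ := B.block_ne_bot.1 h
  have hsup : a ∈ iSup 𝒜.component := by
    rw [𝒜.isInternal.submodule_iSup_eq_top]; trivial
  obtain ⟨f, hf, rfl⟩ := (Submodule.mem_iSup_iff_exists_finsupp _ _).1 hsup
  rw [Finsupp.sum, Finset.mul_sum, Finset.sum_mul] at ha
  obtain ⟨g, -, hg⟩ := Finset.exists_ne_zero_of_sum_ne_zero ha
  refine ⟨g, _, ?_, hg, ?_⟩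
  · have := 𝒜.mul_mem (𝒜.mul_mem (B.unit_mem i) (hf g)) (B.unit_mem j)
    rwa [one_mul, mul_one] at this
  · simp only [mul_assoc, B.unit_mul_self]
    simp only [← mul_assoc, B.unit_mul_self]

/-- A nonzero homogeneous element of a block has no annihilator in the right diagonal block. -/
theorem mul_diag_ne_zero (B : BlockForm 𝒜 H) {j : Fin t} {g : G} {m : A}
    (hm : m ∈ 𝒜.component g) (hm0 : m ≠ 0) (hmj : m * B.unit j = m)
    {c : MonoidAlgebra F (H j)} (hc : B.diag j c ≠ 0) : m * B.diag j c ≠ 0 := by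
  classical
  let v : H j → A := fun h ↦ m * B.diag j (MonoidAlgebra.single h 1)
  have hinj : Function.Injective (fun h : H j ↦ g * (h : G)) := fun a b hab ↦
    Subtype.ext (mul_left_cancel hab)
  have hli : LinearIndependent F v := by
    refine (𝒜.isInternal.submodule_iSupIndep.comp hinj).linearIndependent _
      (fun h ↦ 𝒜.mul_mem hm (B.diag_mem j h)) (fun h h0 ↦ hm0 ?_)
    have h1 : v h * B.diag j (MonoidAlgebra.single h⁻¹ 1) = m := by
      simp only [v]
      rw [mul_assoc, ← map_mul, MonoidAlgebra.single_mul_single, mul_inv_cancel, one_mul]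
      exact hmj
    rw [← h1, h0, zero_mul]
  intro h0
  apply hc
  have hsum : ∀ c : MonoidAlgebra F (H j),
      Finsupp.linearCombination F v c.coeff = m * B.diag j c := by
    intro c
    induction c using MonoidAlgebra.induction_on with
    | of h => simp [v, MonoidAlgebra.of, Finsupp.linearCombination_single]
    | add x y hx hy => simp [hx, hy, mul_add]
    | smul r x hx => simp [hx]
  have hc0 : c.coeff = 0 := (linearIndependent_iff.1 hli) _ ((hsum c).trans h0)
  have : c = 0 := by
    cases c
    simp_all
  rw [this, map_zero]

end General

section Incidence

variable {F G X : Type*} [Field F] [Group G] [PartialOrder X] [LocallyFiniteOrder X]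
  [DecidableEq X]

/-- The matrix unit `e_{xy}`, for `x ≤ y`. -/
def matrixUnit (F : Type*) [Field F] {x y : X} (h : x ≤ y) : IncidenceAlgebra F X :=
  ⟨fun a b ↦ if a = x ∧ b = y then 1 else 0, fun a b hab ↦ if_neg (by
    rintro ⟨rfl, rfl⟩; exact hab h)⟩

theorem matrixUnit_apply {x y : X} (h : x ≤ y) (a b : X) :
    matrixUnit F h a b = if a = x ∧ b = y then 1 else 0 := rfl

theorem mul_matrixUnit_mul_apply (f f' : IncidenceAlgebra F X) {x y : X} (h : x ≤ y) :
    (f * matrixUnit F h * f') x y = f x x * f' y y := by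
  rw [IncidenceAlgebra.mul_apply, Finset.sum_eq_single y]
  · rw [IncidenceAlgebra.mul_apply, Finset.sum_eq_single x]
    · simp [matrixUnit_apply]
    · intro b _ hb
      simp [matrixUnit_apply, hb]
    · simp [h]
  · intro b _ hb
    rw [IncidenceAlgebra.mul_apply, Finset.sum_eq_zero, zero_mul]
    intro c _
    simp [matrixUnit_apply, hb]
  · simp [h]

/-- For idempotents `e, f` of an incidence algebra, `e I(X) f ≠ 0` if and only if there are
`x ≤ y` such that `e (x, x) ≠ 0` and `f (y, y) ≠ 0`. -/
theorem exists_mul_mul_ne_zero_iff {e f : IncidenceAlgebra F X} (he : e * e = e)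
    (hf : f * f = f) :
    (∃ a, e * a * f ≠ 0) ↔ ∃ x y, x ≤ y ∧ e x x ≠ 0 ∧ f y y ≠ 0 := by
  constructor
  · rintro ⟨a, ha⟩
    set b := e * a * f with hb
    have hbb : e * b * f = b := by
      rw [hb]
      simp only [mul_assoc, hf]
      simp only [← mul_assoc, he]
    have key : ∀ n (x y : X), (Finset.Icc x y).card = n → b x y ≠ 0 →
        ∃ x y, x ≤ y ∧ e x x ≠ 0 ∧ f y y ≠ 0 := by
      intro n
      induction n using Nat.strong_induction_on with
      | _ n ih =>
        intro x y hn hxy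
        by_contra hcon
        have hle : x ≤ y := IncidenceAlgebra.le_of_ne_zero hxy
        have hsmall : ∀ u v, x ≤ u → v ≤ y → (u ≠ x ∨ v ≠ y) → b u v = 0 := by
          intro u v hu hv huv
          by_contra hne
          have huv' : u ≤ v := IncidenceAlgebra.le_of_ne_zero hne
          refine hcon (ih _ ?_ u v rfl hne)
          rw [← hn]
          refine Finset.card_lt_card (Finset.ssubset_iff_subset_ne.2
            ⟨Finset.Icc_subset_Icc hu hv, fun heq ↦ ?_⟩)
          have hx : x ∈ Finset.Icc u v := by rw [heq]; simp [hle]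
          have hy : y ∈ Finset.Icc u v := by rw [heq]; simp [hle]
          rw [Finset.mem_Icc] at hx hy
          rcases huv with h | h
          · exact h (le_antisymm hx.1 hu)
          · exact h (le_antisymm hv hy.2)
        have hval : b x y = e x x * b x y * f y y := by
          conv_lhs => rw [← hbb]
          rw [IncidenceAlgebra.mul_apply, Finset.sum_eq_single y]
          · rw [IncidenceAlgebra.mul_apply, Finset.sum_eq_single x]
            · intro u hu hux
              rw [hsmall u y (Finset.mem_Icc.1 hu).1 le_rfl (Or.inl hux), mul_zero]
            · simp [hle]
          · intro v hv hvy
            rw [IncidenceAlgebra.mul_apply, Finset.sum_eq_zero, zero_mul]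
            intro u hu
            rw [hsmall u v (Finset.mem_Icc.1 hu).1 (Finset.mem_Icc.1 hv).2 (Or.inr hvy),
              mul_zero]
          · simp [hle]
        refine hcon ⟨x, y, hle, fun h ↦ hxy ?_, fun h ↦ hxy ?_⟩
        · rw [hval, h, zero_mul, zero_mul]
        · rw [hval, h, mul_zero]
    by_contra hcon
    apply ha
    ext x y _
    by_contra hxy
    exact hcon (key _ x y rfl hxy)
  · rintro ⟨x, y, h, hx, hy⟩
    refine ⟨matrixUnit F h, fun h0 ↦ mul_ne_zero hx hy ?_⟩
    rw [← mul_matrixUnit_mul_apply e f h, h0]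
    rfl

variable {𝒜 : GroupGrading F G (IncidenceAlgebra F X)} {t : ℕ} {H : Fin t → Subgroup G}

/-- `e_i I(X) e_j ≠ 0` if and only if there are `x ≤ y` in `X` such that `x` lies in the diagonal
support of `e_i` and `y` in the diagonal support of `e_j`. -/
theorem block_ne_bot_iff (B : BlockForm 𝒜 H) (i j : Fin t) :
    B.block i j ≠ ⊥ ↔ ∃ x y, x ≤ y ∧ B.unit i x x ≠ 0 ∧ B.unit j y y ≠ 0 :=
  B.block_ne_bot.trans (exists_mul_mul_ne_zero_iff (B.unit_mul_self i) (B.unit_mul_self j))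

theorem block_trans (B : BlockForm 𝒜 H) {i j k : Fin t} (hij : B.block i j ≠ ⊥)
    (hjk : B.block j k ≠ ⊥) : B.block i k ≠ ⊥ := by
  obtain ⟨y, z, hyz, hy, hz⟩ := (B.block_ne_bot_iff j k).1 hjk
  obtain ⟨g, m, hm, hm0, hmij⟩ := B.exists_homogeneous hij
  have hmj : m * B.unit j = m := by
    rw [← hmij, mul_assoc _ (B.unit j), B.unit_mul_self]
  have hmi : B.unit i * m = m := by
    rw [← hmij, ← mul_assoc, ← mul_assoc, B.unit_mul_self]
  let E : IncidenceAlgebra F X := matrixUnit F (le_refl y)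
  obtain ⟨c, hc⟩ := B.diag_surjective j E
  have hc0 : B.diag j c ≠ 0 := by
    intro h0
    have h1 := mul_matrixUnit_mul_apply (B.unit j) (B.unit j) (le_refl y)
    rw [show B.unit j * matrixUnit F (le_refl y) * B.unit j = 0 from hc.symm.trans h0] at h1
    exact mul_ne_zero hy hy h1.symm
  have hne := B.mul_diag_ne_zero hm hm0 hmj hc0
  have hEE : E * E = E := by
    ext a b _
    simp only [E, IncidenceAlgebra.mul_apply, matrixUnit_apply]
    by_cases ha : a = y <;> by_cases hb : b = y <;> simp [ha, hb]
  have hmE : B.unit i * m * E ≠ 0 := by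
    intro h0
    apply hne
    rw [hc, ← mul_assoc, ← mul_assoc]
    change m * B.unit j * E * B.unit j = 0
    rw [hmj]
    rw [hmi] at h0
    rw [h0, zero_mul]
  obtain ⟨x, y', hxy, hx, hy'⟩ :=
    (exists_mul_mul_ne_zero_iff (B.unit_mul_self i) hEE).1 ⟨m, hmE⟩
  have : y' = y := by
    by_contra h
    exact hy' (by simp [E, matrixUnit_apply, h])
  subst this
  exact (B.block_ne_bot_iff i k).2 ⟨x, z, hxy.trans hyz, hx, hz⟩

/-- The associated poset of a grading on an incidence algebra in block form: the set `{1, …, t}`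
with `i ⊴ j` if and only if `M_{ij} = e_i I(X) e_j ≠ 0`. -/
instance instPartialOrder (B : BlockForm 𝒜 H) : PartialOrder B.AssociatedPoset where
  le i j := B.block (B.index i) (B.index j) ≠ ⊥
  le_refl i := B.block_ne_bot.2 ⟨B.unit (B.index i), by
    rw [B.unit_mul_self, B.unit_mul_self]; exact B.unit_ne_zero _⟩
  le_trans _ _ _ hij hjk := B.block_trans hij hjk
  le_antisymm i j hij hji := by
    by_contra hne
    obtain ⟨a, ha⟩ := B.block_ne_bot.1 hij
    obtain ⟨b, hb⟩ := B.block_ne_bot.1 hji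
    rcases lt_or_gt_of_ne (B.index.injective.ne hne) with h | h
    · exact hb (B.upper _ _ h b)
    · exact ha (B.upper _ _ h a)

theorem associatedPoset_le_iff (B : BlockForm 𝒜 H) (i j : B.AssociatedPoset) :
    i ≤ j ↔ B.block (B.index i) (B.index j) ≠ ⊥ :=
  Iff.rfl

end Incidence

end BlockForm

/-! Pulling the second block form back along the graded isomorphism gives two block forms, with
units `e_i` and `e'_j`, on one graded algebra. Because blocks below the diagonal vanish, the
compression `a ↦ e_i a e_i` is multiplicative (`unit_mul_mul_unit_mul`). The degree-`1` part of `e_i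
A e_i ≅ F H_i` is the line `F e_i`, so each `e'_j`, being an idempotent of degree `1`, compresses to
`0` or `e_i`. As the `e'_j` are orthogonal with sum `1`, exactly one `j` satisfies `e_i e'_j e_i =
e_i`. This relation is symmetric, so it is a bijection `α`. For matched units, compressing a nonzero
element of a block to the corresponding primed block keeps it nonzero and keeps its degree. Hence
`α` preserves nonvanishing of blocks, which is the order, and the degrees in the diagonal blocks,
which are the groups. -/

namespace BlockForm

variable {F G A A' : Type*} [Field F] [Group G] [Ring A] [Algebra F A] [Ring A'] [Algebra F A']
  {𝒜 : GroupGrading F G A} {𝒜' : GroupGrading F G A'} {t t' : ℕ}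
  {H : Fin t → Subgroup G} {H' : Fin t' → Subgroup G}

/-! ### Transport of a block form along a graded isomorphism -/

/-- The block form on a graded algebra induced by a graded isomorphism to an algebra in block
form. -/
noncomputable def comap (B : BlockForm 𝒜' H) (ψ : A ≃ₐ[F] A')
    (hψ : ∀ g : G, (𝒜.component g).map ψ.toLinearMap = 𝒜'.component g) : BlockForm 𝒜 H where
  finite := B.finite
  comm := B.comm
  not_dvd_card := B.not_dvd_card
  primitiveRoot := B.primitiveRoot
  diag i := ((ψ.symm : A' →ₐ[F] A) : A' →ₙₐ[F] A).comp (B.diag i)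
  diag_injective i := ψ.symm.injective.comp (B.diag_injective i)
  diag_mem i h := by
    have hm := B.diag_mem i h
    rw [← hψ] at hm
    obtain ⟨a, ha, hah⟩ := hm
    have : ψ.symm (B.diag i (MonoidAlgebra.single h 1)) = a := by
      rw [← hah]; exact ψ.symm_apply_apply a
    exact this.symm ▸ ha
  diag_surjective i a := by
    obtain ⟨c, hc⟩ := B.diag_surjective i (ψ a)
    refine ⟨c, ?_⟩
    change ψ.symm (B.diag i c) = ψ.symm (B.diag i 1) * a * ψ.symm (B.diag i 1)
    rw [hc, map_mul, map_mul, ψ.symm_apply_apply]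
  orthogonal i j hij := by
    change ψ.symm (B.diag i 1) * ψ.symm (B.diag j 1) = 0
    rw [← map_mul, B.orthogonal i j hij, map_zero]
  complete := by
    change ∑ i, ψ.symm (B.diag i 1) = 1
    rw [← map_sum, B.complete, map_one]
  upper i j hij a := by
    change ψ.symm (B.diag i 1) * a * ψ.symm (B.diag j 1) = 0
    apply ψ.injective
    simpa using B.upper i j hij (ψ a)

theorem comap_unit (B : BlockForm 𝒜' H) (ψ : A ≃ₐ[F] A')
    (hψ : ∀ g : G, (𝒜.component g).map ψ.toLinearMap = 𝒜'.component g) (i : Fin t) :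
    (B.comap ψ hψ).unit i = ψ.symm (B.unit i) :=
  rfl

theorem comap_block_ne_bot (B : BlockForm 𝒜' H) (ψ : A ≃ₐ[F] A')
    (hψ : ∀ g : G, (𝒜.component g).map ψ.toLinearMap = 𝒜'.component g) (i j : Fin t) :
    (B.comap ψ hψ).block i j ≠ ⊥ ↔ B.block i j ≠ ⊥ := by
  rw [block_ne_bot, block_ne_bot, ψ.symm.surjective.exists]
  simp only [comap_unit, ← map_mul]
  exact exists_congr fun a ↦ (map_ne_zero_iff ψ.symm ψ.symm.injective)

/-! ### Degrees and compressions for a single block form -/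

/-- The degrees occurring in the `i`-th diagonal block lie in `H i`. -/
theorem mem_of_unit_mul_mul_unit_ne_zero (B : BlockForm 𝒜 H) {i : Fin t} {g : G} {a : A}
    (ha : a ∈ 𝒜.component g) (h0 : B.unit i * a * B.unit i ≠ 0) : g ∈ H i := by
  classical
  by_contra hg
  obtain ⟨c, hc⟩ := B.diag_surjective i a
  -- The block is spanned by elements of degree in `H i`, all different from `g`, so independence of
  -- the components excludes degree `g`.
  have hsup : ∀ c : MonoidAlgebra F (H i), B.diag i c ∈ ⨆ h ≠ g, 𝒜.component h := by
    intro c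
    induction c using MonoidAlgebra.induction_on with
    | of h =>
      exact Submodule.mem_iSup_of_mem (h : G) (Submodule.mem_iSup_of_mem
        (fun hh ↦ hg (hh ▸ h.2)) (B.diag_mem i h))
    | add x y hx hy => rw [map_add]; exact Submodule.add_mem _ hx hy
    | smul r x hx => rw [map_smul]; exact Submodule.smul_mem _ r hx
  have hdeg : B.unit i * a * B.unit i ∈ 𝒜.component g := by
    simpa using 𝒜.mul_mem (𝒜.mul_mem (B.unit_mem i) ha) (B.unit_mem i)
  refine h0 (Submodule.disjoint_def.1 (𝒜.isInternal.submodule_iSupIndep g) _ hdeg ?_)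
  have := hsup c
  rwa [hc] at this

/-- The component of degree `1` of a diagonal block is spanned by its unit. -/
theorem exists_unit_mul_mul_unit_eq_smul (B : BlockForm 𝒜 H) (i : Fin t) {a : A}
    (ha : a ∈ 𝒜.component 1) : ∃ r : F, B.unit i * a * B.unit i = r • B.unit i := by
  classical
  obtain ⟨c, hc⟩ := B.diag_surjective i a
  -- The scalar `r` is the coefficient of `c` at the identity of `H i`; the rest of `c` lives in
  -- degrees other than `1`.
  have hsup : ∀ c : MonoidAlgebra F (H i),
      ∃ r : F, B.diag i c - r • B.unit i ∈ ⨆ h ≠ (1 : G), 𝒜.component h := by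
    intro c
    induction c using MonoidAlgebra.induction_on with
    | of h =>
      by_cases hh : h = 1
      · refine ⟨1, ?_⟩
        rw [hh, map_one, one_smul, unit, sub_self]
        exact Submodule.zero_mem _
      · refine ⟨0, ?_⟩
        rw [zero_smul, sub_zero]
        exact Submodule.mem_iSup_of_mem (h : G) (Submodule.mem_iSup_of_mem
          (fun h1 ↦ hh (Subtype.ext h1)) (B.diag_mem i h))
    | add x y hx hy =>
      obtain ⟨r, hr⟩ := hx
      obtain ⟨s, hs⟩ := hy
      refine ⟨r + s, ?_⟩
      rw [map_add, add_smul, add_sub_add_comm]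
      exact Submodule.add_mem _ hr hs
    | smul s x hx =>
      obtain ⟨r, hr⟩ := hx
      refine ⟨s * r, ?_⟩
      rw [map_smul, mul_smul, ← smul_sub]
      exact Submodule.smul_mem _ s hr
  have hdeg : B.unit i * a * B.unit i ∈ 𝒜.component 1 := by
    simpa using 𝒜.mul_mem (𝒜.mul_mem (B.unit_mem i) ha) (B.unit_mem i)
  obtain ⟨r, hr⟩ := hsup c
  rw [hc] at hr
  exact ⟨r, sub_eq_zero.1 (Submodule.disjoint_def.1 (𝒜.isInternal.submodule_iSupIndep 1) _
    (Submodule.sub_mem _ hdeg (Submodule.smul_mem _ r (B.unit_mem i))) hr)⟩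

/-- Compression to a diagonal block is multiplicative. -/
theorem unit_mul_mul_unit_mul (B : BlockForm 𝒜 H) (i : Fin t) (a b : A) :
    (B.unit i * a * B.unit i) * (B.unit i * b * B.unit i) = B.unit i * (a * b) * B.unit i := by
  have hsum : a * b = ∑ k, a * B.unit k * b := by
    -- Insert `1 = ∑ e_k` between `a` and `b`. For `k ≠ i`, one of the blocks `(i, k)`, `(k, i)`
    -- lies below the diagonal, so only `k = i` survives.
    rw [← Finset.sum_mul, ← Finset.mul_sum, show ∑ k, B.unit k = 1 from B.complete, mul_one]
  have hterm : ∀ k, B.unit i * (a * B.unit k * b) * B.unit i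
      = (B.unit i * a * B.unit k) * (B.unit k * b * B.unit i) := by
    intro k
    simp only [mul_assoc]
    rw [← mul_assoc (B.unit k) (B.unit k), B.unit_mul_self]
  rw [hsum, Finset.mul_sum, Finset.sum_mul, Finset.sum_eq_single i]
  · exact (hterm i).symm
  · intro k _ hki
    rw [hterm]
    rcases lt_or_gt_of_ne hki with h | h
    · rw [show B.unit i * a * B.unit k = 0 from B.upper i k h a, zero_mul]
    · rw [show B.unit k * b * B.unit i = 0 from B.upper k i h b, mul_zero]
  · simp

/-- The compression of an idempotent of degree `1` to a diagonal block is trivial. -/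
theorem unit_mul_mul_unit_eq_zero_or (B : BlockForm 𝒜 H) (i : Fin t) {f : A}
    (hf : f ∈ 𝒜.component 1) (hff : f * f = f) :
    B.unit i * f * B.unit i = 0 ∨ B.unit i * f * B.unit i = B.unit i := by
  obtain ⟨r, hr⟩ := B.exists_unit_mul_mul_unit_eq_smul i hf
  have h := B.unit_mul_mul_unit_mul i f f
  rw [hff, hr, smul_mul_smul_comm, B.unit_mul_self] at h
  rw [hr]
  have hrr : r * r = r := smul_left_injective F (B.unit_ne_zero i) h
  rcases IsIdempotentElem.iff_eq_zero_or_one.1 hrr with h | h <;> simp [h]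

/-! ### Matching the units of two block forms -/

section Pair

variable (B : BlockForm 𝒜 H) (B' : BlockForm 𝒜 H')

/-- Otherwise every `e'_j` compresses to `0`, and summing over `j` gives `e_i = 0`. -/
theorem exists_unit_mul_unit_mul_unit (i : Fin t) :
    ∃ j, B.unit i * B'.unit j * B.unit i = B.unit i := by
  by_contra! hcon
  apply B.unit_ne_zero i
  have hsum : B.unit i = ∑ j, B.unit i * B'.unit j * B.unit i := by
    rw [← Finset.sum_mul, ← Finset.mul_sum, show ∑ k, B'.unit k = 1 from B'.complete, mul_one,
      B.unit_mul_self]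
  rw [hsum]
  exact Finset.sum_eq_zero fun j _ ↦
    (B.unit_mul_mul_unit_eq_zero_or i (B'.unit_mem j) (B'.unit_mul_self j)).resolve_right (hcon j)

variable {B B'}

/-- Compression sends the product `e'_j e'_k`, zero for `j ≠ k`, to `e_i * e_i = e_i ≠ 0`. -/
theorem eq_of_unit_mul_unit_mul_unit {i : Fin t} {j k : Fin t'}
    (hj : B.unit i * B'.unit j * B.unit i = B.unit i)
    (hk : B.unit i * B'.unit k * B.unit i = B.unit i) : j = k := by
  by_contra hjk
  have h := B.unit_mul_mul_unit_mul i (B'.unit j) (B'.unit k)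
  rw [hj, hk, show B'.unit j * B'.unit k = 0 from B'.orthogonal j k hjk, mul_zero, zero_mul,
    B.unit_mul_self] at h
  exact B.unit_ne_zero i h

/-- By the dichotomy, only `e'_j e_i e'_j = 0` has to be excluded; this element sits inside `e_i
e'_j e_i e'_j e_i = e_i`. -/
theorem unit_mul_unit_mul_unit_symm {i : Fin t} {j : Fin t'}
    (h : B.unit i * B'.unit j * B.unit i = B.unit i) :
    B'.unit j * B.unit i * B'.unit j = B'.unit j := by
  refine (B'.unit_mul_mul_unit_eq_zero_or j (B.unit_mem i) (B.unit_mul_self i)).resolve_left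
    fun h0 ↦ B.unit_ne_zero i ?_
  calc B.unit i = B.unit i * B'.unit j * B.unit i * B'.unit j * B.unit i := by rw [h, h]
    _ = B.unit i * (B'.unit j * B.unit i * B'.unit j) * B.unit i := by simp only [mul_assoc]
    _ = 0 := by rw [h0, mul_zero, zero_mul]

/-- Passing between blocks of matching idempotents loses no nonzero elements. -/
theorem unit_mul_mul_unit_ne_zero {i k : Fin t} {j l : Fin t'}
    (hij : B.unit i * B'.unit j * B.unit i = B.unit i)
    (hkl : B.unit k * B'.unit l * B.unit k = B.unit k) {a : A}
    (ha : B.unit i * a * B.unit k ≠ 0) :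
    B'.unit j * (B.unit i * a * B.unit k) * B'.unit l ≠ 0 := by
  intro h0
  apply ha
  calc B.unit i * a * B.unit k
      = (B.unit i * B'.unit j * B.unit i) * a * (B.unit k * B'.unit l * B.unit k) := by
        rw [hij, hkl]
    _ = B.unit i * (B'.unit j * (B.unit i * a * B.unit k) * B'.unit l) * B.unit k := by
        simp only [mul_assoc]
    _ = 0 := by rw [h0, mul_zero, zero_mul]

theorem block_ne_bot_of_unit_mul {i k : Fin t} {j l : Fin t'}
    (hij : B.unit i * B'.unit j * B.unit i = B.unit i)
    (hkl : B.unit k * B'.unit l * B.unit k = B.unit k) (h : B.block i k ≠ ⊥) :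
    B'.block j l ≠ ⊥ := by
  obtain ⟨a, ha⟩ := B.block_ne_bot.1 h
  exact B'.block_ne_bot.2 ⟨_, unit_mul_mul_unit_ne_zero hij hkl ha⟩

/-- The basis element of `F H_i` at `h` has degree `h` and survives compression by `e'_j`, so `h` is
a degree occurring in `F H'_j`. -/
theorem le_of_unit_mul {i : Fin t} {j : Fin t'}
    (hij : B.unit i * B'.unit j * B.unit i = B.unit i) : H i ≤ H' j := by
  intro h hh
  let b : A := B.diag i (MonoidAlgebra.single ⟨h, hh⟩ 1)
  have hb : B.unit i * b * B.unit i = b := by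
    simp only [b, unit, ← map_mul, one_mul, mul_one]
  have hb0 : b ≠ 0 := by
    intro h0
    have := B.diag_injective i (h0.trans (map_zero _).symm)
    exact one_ne_zero (MonoidAlgebra.single_eq_zero.1 this)
  have hne := unit_mul_mul_unit_ne_zero hij hij (a := b) (by rwa [hb])
  rw [hb] at hne
  exact B'.mem_of_unit_mul_mul_unit_ne_zero (B.diag_mem i ⟨h, hh⟩) hne

variable (B B')

/-- Two block forms of the same graded algebra have the same blocks, up to a permutation. -/
theorem exists_equiv : ∃ α : Fin t ≃ Fin t', (∀ i, H i = H' (α i)) ∧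
    ∀ i k, B'.block (α i) (α k) ≠ ⊥ ↔ B.block i k ≠ ⊥ := by
  choose α hα using B.exists_unit_mul_unit_mul_unit B'
  choose β hβ using B'.exists_unit_mul_unit_mul_unit B
  -- The symmetric relations make `α` and `β` mutually inverse by uniqueness of the match, and give
  -- the reverse inclusions and implications.
  have hα' := fun i ↦ unit_mul_unit_mul_unit_symm (hα i)
  have hβ' := fun j ↦ unit_mul_unit_mul_unit_symm (hβ j)
  refine ⟨⟨α, β, fun i ↦ eq_of_unit_mul_unit_mul_unit (hβ _) (hα' i),
    fun j ↦ eq_of_unit_mul_unit_mul_unit (hα _) (hβ' j)⟩, fun i ↦ ?_, fun i k ↦ ?_⟩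
  · exact le_antisymm (le_of_unit_mul (hα i)) (le_of_unit_mul (hα' i))
  · exact ⟨block_ne_bot_of_unit_mul (hα' i) (hα' k), block_ne_bot_of_unit_mul (hα i) (hα k)⟩

end Pair

end BlockForm

theorem mainTheorem6 {F G X : Type*} [Field F] [Group G] [PartialOrder X] [Finite X]
    [LocallyFiniteOrder X] [DecidableEq X]
    (hFG : ringChar F = 0 ∨ Module.finrank F (IncidenceAlgebra F X) < ringChar F ∨
      ∀ g h : G, g * h = h * g)
    (𝒜 𝒜' : GroupGrading F G (IncidenceAlgebra F X)) {t t' : ℕ}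
    (H : Fin t → Subgroup G) (H' : Fin t' → Subgroup G)
    (B : BlockForm 𝒜 H) (B' : BlockForm 𝒜' H') (hiso : 𝒜.Isomorphic 𝒜') :
    t = t' ∧ ∃ α : B.AssociatedPoset ≃o B'.AssociatedPoset,
      ∀ i : B.AssociatedPoset, H (B.index i) = H' (B'.index (α i)) := by
  obtain ⟨ψ, hψ⟩ := hiso
  obtain ⟨α, hH, hα⟩ := B.exists_equiv (B'.comap ψ hψ)
  refine ⟨Fin.equiv_iff_eq.1 ⟨α⟩, ⟨(B.index.trans α).trans B'.index.symm, fun {i k} ↦ ?_⟩,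
    fun i ↦ hH (B.index i)⟩
  -- Both orders unfold to nonvanishing of blocks, which the pullback does not affect.
  exact (B'.comap_block_ne_bot ψ hψ _ _).symm.trans (hα (B.index i) (B.index k))
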